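/- **Setting.** Let $n\ge 1$, $K\ge 2$ and $1\le d\le K$. Let $v_1,\dots,v_K\in\mathbb R^d$ be the vertices of a (possibly degenerate) simplex, the rows of a matrix $V\in\mathbb R^{K\times d}$. Let $w_1,\dots,w_n\in\mathbb R^K$ be weight vectors (nonnegative entries with sum $1$), and observe $$x_i=r_i+\epsilon_i,\qquad r_i=\sum_{k=1}^K w_i(k)\,v_k,\qquad i=1,\dots,n,$$ with independent random noise vectors $\epsilon_1,\dots,\epsilon_n\in\mathbb R^d$ (in particular, i.i.d. noise is allowed). Let $S\subset\{1,\dots,n\}$, $N=|S|$, and for $i\in S$ let $\pi_i\in\mathbb R^K$ be a weight vector with $$w_i=(b\circ\pi_i)/\|b\circ\pi_i\|_1,\qquad i\in S,$$ where $b\in\mathbb R^K$ has positive entries and $\|b\|=1$, and $\circ$ is the entrywise product. Let $W_S,\Pi_S\in\mathbb R^{N\times K}$ and $X_S\in\mathbb R^{N\times d}$ have rows $w_i'$, $\pi_i'$, $x_i'$, $i\in S$. Write $\|\cdot\|$ for the Euclidean norm of a vector and the spectral norm of a matrix, and $\lambda_k(A)$ for the $k$-th largest singular value of $A$ (equal to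 $0$ if $k$ exceeds the number of rows or columns); for $\Pi_S$, $\lambda_{\max}=\lambda_1$ and $\lambda_{\min}=\lambda_K$. Let $\alpha\in\mathbb R^N$ with $\|\alpha\|=1$, $H=I_N-\Pi_S(\Pi_S'\Pi_S)^{-1}\Pi_S'$, $\bar w_*=\frac1N\sum_{i\in S}w_i$ and $$\Sigma(\alpha)=\frac1N\sum_{i\in S}(H\alpha)_i\,(\pi_i'b)\,(w_i-\bar w_*)(w_i-\bar w_*)'.$$ **Assumptions.** For constants $c_1,c_2,c_3,c_4>0$ and some $\sigma_n>0$: 1. $\|V\|\ge c_1$ and $\lambda_{K-1}(V)\ge c_1\|V\|$; $\lambda_{\min}(\Pi_S)\ge c_2\lambda_{\max}(\Pi_S)$; $\min_k b_k\ge c_3\max_k b_k$. 2. $\mathbb E[\exp(t\epsilon_{ij})]\le\exp(t^2\sigma_n^2/2)$ for all $i\in S$, all coordinates $j\le d$ and all $t\in\mathbb R$. 3. $\lambda_{K-1}(\Sigma(\alpha))\ge c_4/\sqrt{KN}$. 4. $N>c_6^{-2}\,\sigma_n^2\,\bigl(K^2+C_{\rm err}^2K^{1.5}\log n\bigr)$,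 where $c_6,C_{\rm err}>0$ are arbitrary constants. **Conclusion.** There are an absolute constant $C_0>0$ and a constant $\tilde C>0$ depending only on $c_1,c_2,c_3,c_4$ and $C_{\rm err}$ such that, under these assumptions, $W_S'W_S$ is invertible and the oracle regression estimator $\widehat V^*=(W_S'W_S)^{-1}W_S'X_S$ (which is computed from the true $b$) satisfies, with probability at least $1-C_0/n$, $$\|\widehat V^*-V\|\le\|V\|\cdot\tilde C\,N^{-1/2}K^{1.25}\,\sigma_n\sqrt{\log n}.$$ -/

import Mathlib

open MeasureTheory ProbabilityTheory Matrix
open scoped Matrix.Norms.L2Operator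

/-! Below, `‖A‖` of a real matrix `A` is the spectral norm (the `ℓ²` operator norm). Vectors are
functions `ι → ℝ`; their Euclidean norm is written `‖WithLp.toLp 2 v‖`. -/

namespace SSVH

/-- The `k`-th largest singular value `λ_k(A)`, `k = 1, 2, …`, of a real `m × p` matrix, that is the
square root of the `k`-th largest of the `p` eigenvalues of `Aᵀ A` (Mathlib counts from `0`). -/
noncomputable def sv {m p : Type*} [Fintype m] [Fintype p] [DecidableEq p]
    (A : Matrix m p ℝ) (k : ℕ) : ℝ :=
  (Matrix.toEuclideanLin A).singularValues (k - 1)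

/-- The rows `y i`, `i ∈ S`, stacked into an `|S| × p` matrix. -/
def stack {n p : ℕ} (S : Finset (Fin n)) (y : Fin n → Fin p → ℝ) : Matrix S (Fin p) ℝ :=
  Matrix.of fun i j => y i j

/-- `(b ∘ p) / ‖b ∘ p‖₁`, with `∘` the entrywise product. -/
noncomputable def reweight {K : ℕ} (b p : Fin K → ℝ) : Fin K → ℝ :=
  fun k => b k * p k / ∑ l, |b l * p l|

/-- The noiseless point `r = ∑ k, w(k) v_k`, where `v_k` is the `k`-th row of `V`. -/
def signal {K d : ℕ} (V : Matrix (Fin K) (Fin d) ℝ) (w : Fin K → ℝ) : Fin d → ℝ :=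
  ∑ k, w k • V k

/-- The projection matrix `I - P (Pᵀ P)⁻¹ Pᵀ` onto the orthogonal complement of the column space
of `P` (a matrix of full column rank). -/
noncomputable def residualProj {m : Type*} [Fintype m] [DecidableEq m] {K : ℕ}
    (P : Matrix m (Fin K) ℝ) : Matrix m m ℝ :=
  1 - P * (Pᵀ * P)⁻¹ * Pᵀ

/-- The mean of the rows of `W`. -/
noncomputable def rowMean {m : Type*} [Fintype m] {K : ℕ} (W : Matrix m (Fin K) ℝ) : Fin K → ℝ :=
  (1 / (Fintype.card m : ℝ)) • ∑ i, W i

/-- `Σ(α) = N⁻¹ ∑ i, (H α)_i (π_iᵀ b) (w_i - w̄) (w_i - w̄)ᵀ`, where the `π_i` and the `w_i` are the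
rows of `P` and of `W`, `w̄` is the mean of the `w_i` and `H = residualProj P`. -/
noncomputable def SigmaMat {m : Type*} [Fintype m] [DecidableEq m] {K : ℕ}
    (P W : Matrix m (Fin K) ℝ) (b : Fin K → ℝ) (α : m → ℝ) : Matrix (Fin K) (Fin K) ℝ :=
  (1 / (Fintype.card m : ℝ)) •
    ∑ i, ((residualProj P *ᵥ α) i * (P i ⬝ᵥ b)) •
      Matrix.vecMulVec (W i - rowMean W) (W i - rowMean W)

/-- The regression estimator `(Wᵀ W)⁻¹ Wᵀ X`. -/
noncomputable def regression {m : Type*} [Fintype m] {K d : ℕ}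
    (W : Matrix m (Fin K) ℝ) (X : Matrix m (Fin d) ℝ) : Matrix (Fin K) (Fin d) ℝ :=
  (Wᵀ * W)⁻¹ * Wᵀ * X

/-- The weights of the model: every `w_i` is a weight vector, every label `π_i`, `i ∈ S` (the rows
of `P`), is a weight vector, `b` is positive with unit Euclidean norm, and
`w_i = (b ∘ π_i) / ‖b ∘ π_i‖₁` for `i ∈ S`. -/
structure LabelModel {n K : ℕ} (S : Finset (Fin n)) (w : Fin n → Fin K → ℝ)
    (P : Matrix S (Fin K) ℝ) (b : Fin K → ℝ) : Prop where
  w_mem : ∀ i, w i ∈ stdSimplex ℝ (Fin K)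
  label_mem : ∀ i, P i ∈ stdSimplex ℝ (Fin K)
  b_pos : ∀ k, 0 < b k
  b_norm : ‖WithLp.toLp 2 b‖ = 1
  w_eq : ∀ i : S, w i = reweight b (P i)

/-- The noise: `ε_1, …, ε_n` are independent random vectors, and the coordinates of `ε_i`, `i ∈ S`,
satisfy `E exp(t ε_ij) ≤ exp(t² σ² / 2)` for all real `t` (in particular they have mean `0`). -/
structure NoiseModel {Ω : Type*} [MeasurableSpace Ω] (μ : Measure Ω) {n d : ℕ} (S : Finset (Fin n))
    (ε : Fin n → Ω → Fin d → ℝ) (σ : ℝ) : Prop where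
  measurable : ∀ i, Measurable (ε i)
  indep : iIndepFun ε μ
  subgaussian : ∀ i ∈ S, ∀ j, HasSubgaussianMGF (fun ω => ε i ω j) (Real.toNNReal (σ ^ 2)) μ

/-- The regularity conditions on the vertex matrix `V`, on the label matrix `P` and on `b`. -/
structure Regular {m : Type*} [Fintype m] {K d : ℕ} (c₁ c₂ c₃ : ℝ)
    (V : Matrix (Fin K) (Fin d) ℝ) (P : Matrix m (Fin K) ℝ) (b : Fin K → ℝ) : Prop where
  norm_V : c₁ ≤ ‖V‖
  sv_V : c₁ * ‖V‖ ≤ sv V (K - 1)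
  sv_P : c₂ * sv P 1 ≤ sv P K
  b_balanced : ∀ k l, c₃ * b l ≤ b k

end SSVH

/-! The spectral condition on `Σ(α)` forces `K` to be bounded by a constant, so crude estimates
suffice. Each `w_i - w̄` has squared length at most 2 and `H` is a contraction, so the squared
Frobenius norm of `Σ(α)` is at most `4 (max b)² / N`; balance and `‖b‖ = 1` give `(max b)² ≤ 1 /
(c₃² K)`. Since `K - 1` squared singular values are at least `c₄² / (K N)`, it follows that `K ≤ 1 +
4 / (c₃ c₄)²` (`vertex_count_le`).

The error of the estimator is `(WᵀW)⁻¹ Wᵀ E`, with `E` the noise matrix. Rows of `P` sum to 1, so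
`λ₁(P)² ≥ N / K`; conditioning of `P` and balance of `b` then give `WᵀW ≥ (c₂ c₃)² N / K`
(`sum_mulVec_sq_le_of_reweight`). Entries of `Wᵀ E` are sub-Gaussian with variance proxy `N σ²`, and
a union bound controls them all at scale `σ √(N log n)`. The remaining powers of `K` go into the
constant. -/

namespace SSVH

/-! ### Singular values and quadratic forms -/

section LinearMap

open LinearMap Module

variable {E F : Type*} [NormedAddCommGroup E] [InnerProductSpace ℝ E] [FiniteDimensional ℝ E]
  [NormedAddCommGroup F] [InnerProductSpace ℝ F] [FiniteDimensional ℝ F] (T : E →ₗ[ℝ] F)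

theorem norm_sq_apply_eq_sum_singularValues {n : ℕ} (hn : finrank ℝ E = n) (v : E) :
    ‖T v‖ ^ 2 = ∑ i : Fin n, T.singularValues i ^ 2 *
      inner ℝ (T.isSymmetric_adjoint_comp_self.eigenvectorBasis hn i) v ^ 2 := by
  set e := T.isSymmetric_adjoint_comp_self.eigenvectorBasis hn
  have h1 : ‖T v‖ ^ 2 = inner ℝ v ((adjoint T ∘ₗ T) v) := by
    rw [LinearMap.comp_apply, LinearMap.adjoint_inner_right, real_inner_self_eq_norm_sq]
  rw [h1, ← e.sum_inner_mul_inner]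
  refine Finset.sum_congr rfl fun i _ => ?_
  rw [← T.isSymmetric_adjoint_comp_self (e i) v,
    T.isSymmetric_adjoint_comp_self.apply_eigenvectorBasis hn i, T.sq_singularValues_fin hn,
    inner_smul_left, real_inner_comm]
  simp [e]
  ring

theorem norm_sq_apply_le {n : ℕ} (hn : finrank ℝ E = n) (v : E) :
    ‖T v‖ ^ 2 ≤ T.singularValues 0 ^ 2 * ‖v‖ ^ 2 := by
  rw [norm_sq_apply_eq_sum_singularValues T hn,
    ← (T.isSymmetric_adjoint_comp_self.eigenvectorBasis hn).sum_sq_inner_right v, Finset.mul_sum]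
  gcongr
  · exact T.singularValues_nonneg _
  · exact T.singularValues_antitone (Nat.zero_le _)

theorem le_norm_sq_apply {n : ℕ} (hn : finrank ℝ E = n) (v : E) :
    T.singularValues (n - 1) ^ 2 * ‖v‖ ^ 2 ≤ ‖T v‖ ^ 2 := by
  rw [norm_sq_apply_eq_sum_singularValues T hn,
    ← (T.isSymmetric_adjoint_comp_self.eigenvectorBasis hn).sum_sq_inner_right v, Finset.mul_sum]
  gcongr with i
  · exact T.singularValues_nonneg _
  · exact T.singularValues_antitone (by omega)

theorem norm_sq_apply_eigenvectorBasis {n : ℕ} (hn : finrank ℝ E = n) (i : Fin n) :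
    ‖T (T.isSymmetric_adjoint_comp_self.eigenvectorBasis hn i)‖ ^ 2 =
      T.singularValues i ^ 2 := by
  rw [norm_sq_apply_eq_sum_singularValues T hn]
  simp [OrthonormalBasis.inner_eq_ite]

end LinearMap

/-! ### Spectral norm, Frobenius norm and Gram matrices -/

section Matrix

variable {m p : Type*} [Fintype m] [Fintype p]

theorem norm_toLp_sq_eq_sum (v : p → ℝ) : ‖WithLp.toLp 2 v‖ ^ 2 = ∑ i, v i ^ 2 := by
  simp [EuclideanSpace.norm_sq_eq]

variable [DecidableEq p]

theorem sum_mulVec_sq_le_sv {K : ℕ} (A : Matrix m (Fin K) ℝ) (v : Fin K → ℝ) :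
    ∑ i, (A *ᵥ v) i ^ 2 ≤ sv A 1 ^ 2 * ∑ k, v k ^ 2 := by
  have h : ‖WithLp.toLp 2 (A *ᵥ v)‖ ^ 2 ≤ _ :=
    norm_sq_apply_le (Matrix.toEuclideanLin A) (n := K) (by simp) (WithLp.toLp 2 v)
  rwa [norm_toLp_sq_eq_sum, norm_toLp_sq_eq_sum] at h

theorem sv_mul_le_sum_mulVec_sq {K : ℕ} (A : Matrix m (Fin K) ℝ) (v : Fin K → ℝ) :
    sv A K ^ 2 * ∑ k, v k ^ 2 ≤ ∑ i, (A *ᵥ v) i ^ 2 := by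
  have h : _ ≤ ‖WithLp.toLp 2 (A *ᵥ v)‖ ^ 2 :=
    le_norm_sq_apply (Matrix.toEuclideanLin A) (n := K) (by simp) (WithLp.toLp 2 v)
  rwa [norm_toLp_sq_eq_sum, norm_toLp_sq_eq_sum] at h

theorem sv_nonneg (A : Matrix m p ℝ) (k : ℕ) : 0 ≤ sv A k :=
  LinearMap.singularValues_nonneg _ _

/-- Both sides are the trace of `Aᵀ A`: sum `‖A e_k‖²` over an eigenbasis, then apply Parseval to
each row. -/
theorem sum_singularValues_sq_eq {K : ℕ} (A : Matrix m (Fin K) ℝ) :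
    ∑ k : Fin K, (Matrix.toEuclideanLin A).singularValues k ^ 2 = ∑ i, ∑ k, A i k ^ 2 := by
  have hn : Module.finrank ℝ (EuclideanSpace ℝ (Fin K)) = K := by simp
  set T := Matrix.toEuclideanLin A
  set e := T.isSymmetric_adjoint_comp_self.eigenvectorBasis hn
  have h : ∀ k i, (T (e k)) i = inner ℝ (e k) (WithLp.toLp 2 (A i)) := by
    intro k i
    simp [T, Matrix.toLpLin_apply, Matrix.mulVec, dotProduct, PiLp.inner_apply]
  simp_rw [← norm_sq_apply_eigenvectorBasis T hn, EuclideanSpace.norm_sq_eq, Real.norm_eq_abs,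
    sq_abs]
  rw [Finset.sum_comm]
  refine Finset.sum_congr rfl fun i _ => ?_
  refine (Finset.sum_congr rfl fun k _ => congrArg (· ^ 2) (h k i)).trans ?_
  rw [e.sum_sq_inner_right, norm_toLp_sq_eq_sum]

theorem mul_sv_sq_le_sum_sq {K : ℕ} (A : Matrix m (Fin K) ℝ) {r : ℕ} (hr : r ≤ K) :
    (r : ℝ) * sv A r ^ 2 ≤ ∑ i, ∑ k, A i k ^ 2 := by
  rw [← sum_singularValues_sq_eq, Fin.sum_univ_eq_sum_range
    (fun k => (Matrix.toEuclideanLin A).singularValues k ^ 2) K]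
  calc (r : ℝ) * sv A r ^ 2 = ∑ _k ∈ Finset.range r, sv A r ^ 2 := by simp
    _ ≤ ∑ k ∈ Finset.range r, (Matrix.toEuclideanLin A).singularValues k ^ 2 := by
      refine Finset.sum_le_sum fun k hk => pow_le_pow_left₀ (sv_nonneg A r) ?_ 2
      exact LinearMap.singularValues_antitone _ (by have := Finset.mem_range.1 hk; omega)
    _ ≤ _ := Finset.sum_le_sum_of_subset_of_nonneg (Finset.range_mono hr)
      fun _ _ _ => sq_nonneg _

theorem l2_opNorm_le_of_sum_mulVec_sq_le (A : Matrix m p ℝ) {C : ℝ} (hC : 0 ≤ C)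
    (h : ∀ v, ∑ i, (A *ᵥ v) i ^ 2 ≤ C ^ 2 * ∑ j, v j ^ 2) : ‖A‖ ≤ C := by
  rw [Matrix.l2_opNorm_def]
  refine ContinuousLinearMap.opNorm_le_bound _ hC fun x => ?_
  refine le_of_sq_le_sq ?_ (by positivity)
  rw [mul_pow, EuclideanSpace.norm_sq_eq, EuclideanSpace.norm_sq_eq]
  simpa using h x

theorem l2_opNorm_le_of_abs_entry_le (A : Matrix m p ℝ) {t : ℝ} (ht : 0 ≤ t)
    (h : ∀ i j, |A i j| ≤ t) : ‖A‖ ≤ √(Fintype.card m * Fintype.card p) * t := by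
  refine l2_opNorm_le_of_sum_mulVec_sq_le A (by positivity) fun v => ?_
  have hrow : ∀ i, (A *ᵥ v) i ^ 2 ≤ (Fintype.card p * t ^ 2) * ∑ j, v j ^ 2 := by
    intro i
    refine (Finset.sum_mul_sq_le_sq_mul_sq Finset.univ (A i) v).trans ?_
    gcongr
    calc ∑ j, A i j ^ 2 ≤ ∑ _j : p, t ^ 2 :=
          Finset.sum_le_sum fun j _ => sq_le_sq.2 ((h i j).trans (le_abs_self t))
      _ = _ := by simp
  calc ∑ i, (A *ᵥ v) i ^ 2 ≤ ∑ _i : m, (Fintype.card p * t ^ 2) * ∑ j, v j ^ 2 :=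
        Finset.sum_le_sum fun i _ => hrow i
    _ = _ := by
      rw [mul_pow, Real.sq_sqrt (by positivity)]
      simp
      ring

theorem isUnit_gram_of_le (W : Matrix m p ℝ) {κ : ℝ} (hκ : 0 < κ)
    (h : ∀ v, κ * ∑ j, v j ^ 2 ≤ ∑ i, (W *ᵥ v) i ^ 2) : IsUnit (Wᵀ * W) := by
  rw [← Matrix.mulVec_injective_iff_isUnit, ← Matrix.coe_mulVecLin, ← LinearMap.ker_eq_bot,
    LinearMap.ker_eq_bot']
  intro v hv
  have h0 : ∑ i, (W *ᵥ v) i ^ 2 = 0 := by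
    have : (W *ᵥ v) ⬝ᵥ (W *ᵥ v) = v ⬝ᵥ ((Wᵀ * W) *ᵥ v) := by
      rw [← Matrix.mulVec_mulVec, Matrix.dotProduct_mulVec v Wᵀ, Matrix.vecMul_transpose]
    rw [Matrix.mulVecLin_apply] at hv
    rw [hv, dotProduct_zero] at this
    simpa [dotProduct, sq] using this
  have h1 : ∑ j, v j ^ 2 = 0 :=
    le_antisymm (nonpos_of_mul_nonpos_right ((h v).trans h0.le) hκ)
      (Finset.sum_nonneg fun _ _ => sq_nonneg _)
  ext j
  simpa using (Finset.sum_eq_zero_iff_of_nonneg fun _ _ => sq_nonneg _).1 h1 j (Finset.mem_univ j)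

/-- With `v = (WᵀW)⁻¹ y`, coercivity and Cauchy-Schwarz give `κ ‖v‖² ≤ ‖W v‖² = ⟨v, y⟩ ≤ ‖v‖ ‖y‖`.
-/
theorem l2_opNorm_inv_gram_le (W : Matrix m p ℝ) {κ : ℝ} (hκ : 0 < κ)
    (h : ∀ v, κ * ∑ j, v j ^ 2 ≤ ∑ i, (W *ᵥ v) i ^ 2) : ‖(Wᵀ * W)⁻¹‖ ≤ κ⁻¹ := by
  have hU := (Matrix.isUnit_iff_isUnit_det _).1 (isUnit_gram_of_le W hκ h)
  refine l2_opNorm_le_of_sum_mulVec_sq_le _ (by positivity) fun y => ?_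
  set v := (Wᵀ * W)⁻¹ *ᵥ y
  have hy : (Wᵀ * W) *ᵥ v = y := by
    simp [v, Matrix.mulVec_mulVec, Matrix.mul_nonsing_inv _ hU]
  have h1 : ∑ i, (W *ᵥ v) i ^ 2 = ∑ j, v j * y j := by
    have : (W *ᵥ v) ⬝ᵥ (W *ᵥ v) = v ⬝ᵥ ((Wᵀ * W) *ᵥ v) := by
      rw [← Matrix.mulVec_mulVec, Matrix.dotProduct_mulVec v Wᵀ, Matrix.vecMul_transpose]
    rw [hy] at this
    simpa [dotProduct, sq] using this
  have h2 := (h v).trans h1.le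
  have h3 := Finset.sum_mul_sq_le_sq_mul_sq Finset.univ v y
  have hv0 : 0 ≤ ∑ j, v j ^ 2 := Finset.sum_nonneg fun _ _ => sq_nonneg _
  have hy0 : 0 ≤ ∑ j, y j ^ 2 := Finset.sum_nonneg fun _ _ => sq_nonneg _
  rw [inv_pow, inv_mul_eq_div, le_div_iff₀ (by positivity)]
  rcases hv0.eq_or_lt with h0 | h0
  · rw [← h0, zero_mul]
    exact hy0
  · have h4 : (κ * ∑ j, v j ^ 2) ^ 2 ≤ (∑ j, v j ^ 2) * ∑ j, y j ^ 2 :=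
      (pow_le_pow_left₀ (by positivity) h2 2).trans h3
    refine le_of_mul_le_mul_left ?_ h0
    linarith

end Matrix

end SSVH

namespace SSVH

/-! ### Bounding the number of vertices; conditioning of the weights -/

section Weights

variable {m : Type*} [Fintype m] {K : ℕ}

theorem sum_residualProj_mulVec_sq_le [DecidableEq m] (P : Matrix m (Fin K) ℝ)
    (hP : IsUnit (Pᵀ * P)) (α : m → ℝ) :
    ∑ i, (residualProj P *ᵥ α) i ^ 2 ≤ ∑ i, α i ^ 2 := by
  have hU := (Matrix.isUnit_iff_isUnit_det _).1 hP
  have hsymm : (residualProj P)ᵀ = residualProj P := by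
    simp [residualProj, Matrix.transpose_nonsing_inv, Matrix.mul_assoc]
  have hidem : residualProj P * residualProj P = residualProj P := by
    have : P * (Pᵀ * P)⁻¹ * Pᵀ * (P * (Pᵀ * P)⁻¹ * Pᵀ) = P * (Pᵀ * P)⁻¹ * Pᵀ := by
      calc _ = P * ((Pᵀ * P)⁻¹ * (Pᵀ * P)) * (Pᵀ * P)⁻¹ * Pᵀ := by simp only [Matrix.mul_assoc]
        _ = _ := by rw [Matrix.nonsing_inv_mul _ hU, Matrix.mul_one]
    rw [residualProj, Matrix.sub_mul, Matrix.one_mul, Matrix.mul_sub, Matrix.mul_one, this]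
    simp
  set y := residualProj P *ᵥ α with hy
  have h1 : ∑ i, y i ^ 2 = ∑ i, α i * y i := by
    have : y ⬝ᵥ y = α ⬝ᵥ y := by
      nth_rewrite 1 [hy]
      rw [← Matrix.vecMul_transpose, hsymm, ← Matrix.dotProduct_mulVec, hy, Matrix.mulVec_mulVec,
        hidem]
    simpa [dotProduct, sq] using this
  have h2 := Finset.sum_le_sum (s := Finset.univ)
    fun i _ => (two_mul_le_add_sq (α i) (y i) : 2 * α i * y i ≤ _)
  -- Symmetry and idempotence gave `‖y‖² = ⟨α, y⟩`, and `2⟨α, y⟩ ≤ ‖α‖² + ‖y‖²`.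
  simp only [mul_assoc, ← Finset.mul_sum, Finset.sum_add_distrib] at h2
  linarith

/-- Cauchy-Schwarz with weights `|g i|` bounds each entry by a product of a factor in `k` and a
factor in `l`, so the double sum factors. -/
theorem sum_sum_sq_sum_mul_le (g : m → ℝ) (U : m → Fin K → ℝ) :
    ∑ k, ∑ l, (∑ i, g i * (U i k * U i l)) ^ 2 ≤ (∑ i, |g i| * ∑ k, U i k ^ 2) ^ 2 := by
  calc ∑ k, ∑ l, (∑ i, g i * (U i k * U i l)) ^ 2
      ≤ ∑ k, ∑ l, (∑ i, |g i| * U i k ^ 2) * ∑ i, |g i| * U i l ^ 2 := by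
        refine Finset.sum_le_sum fun k _ => Finset.sum_le_sum fun l _ => ?_
        refine Finset.sum_sq_le_sum_mul_sum_of_sq_le_mul _ (fun i _ => by positivity)
          (fun i _ => by positivity) fun i _ => le_of_eq ?_
        rw [mul_pow, ← sq_abs (g i)]
        ring
    _ = (∑ i, |g i| * ∑ k, U i k ^ 2) ^ 2 := by
        rw [← Finset.sum_mul_sum, ← sq]
        simp_rw [Finset.mul_sum]
        rw [Finset.sum_comm]

theorem rowMean_apply (W : Matrix m (Fin K) ℝ) (k : Fin K) :
    rowMean W k = (1 / (Fintype.card m : ℝ)) * ∑ i, W i k := by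
  exact congrArg _ (Finset.sum_apply k Finset.univ fun i => W i)

theorem rowMean_mem_stdSimplex [Nonempty m] {W : Matrix m (Fin K) ℝ}
    (hW : ∀ i, W i ∈ stdSimplex ℝ (Fin K)) : rowMean W ∈ stdSimplex ℝ (Fin K) := by
  have hm : (Fintype.card m : ℝ) ≠ 0 := by simp
  refine ⟨fun k => ?_, ?_⟩
  · rw [rowMean_apply]
    exact mul_nonneg (by positivity) (Finset.sum_nonneg fun i _ => (hW i).1 k)
  · simp_rw [rowMean_apply, ← Finset.mul_sum]
    rw [Finset.sum_comm]
    simp [fun i => (hW i).2, hm]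

theorem le_one_of_mem_stdSimplex {p : Fin K → ℝ} (hp : p ∈ stdSimplex ℝ (Fin K)) (k : Fin K) :
    p k ≤ 1 :=
  hp.2 ▸ Finset.single_le_sum (fun l _ => hp.1 l) (Finset.mem_univ k)

theorem sum_sub_sq_le_two {p q : Fin K → ℝ} (hp : p ∈ stdSimplex ℝ (Fin K))
    (hq : q ∈ stdSimplex ℝ (Fin K)) : ∑ k, (p - q) k ^ 2 ≤ 2 := by
  calc ∑ k, (p - q) k ^ 2 ≤ ∑ k, (p k + q k) := by
        refine Finset.sum_le_sum fun k _ => ?_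
        have h1 := hp.1 k
        have h2 := hq.1 k
        have h3 := le_one_of_mem_stdSimplex hp k
        have h4 := le_one_of_mem_stdSimplex hq k
        rw [Pi.sub_apply]
        nlinarith [mul_nonneg h1 h2]
    _ = 2 := by rw [Finset.sum_add_distrib, hp.2, hq.2]; norm_num

theorem sum_sq_SigmaMat_le [DecidableEq m] [Nonempty m] {P W : Matrix m (Fin K) ℝ}
    {b : Fin K → ℝ} {α : m → ℝ} {β : ℝ} (hP : ∀ i, P i ∈ stdSimplex ℝ (Fin K))
    (hW : ∀ i, W i ∈ stdSimplex ℝ (Fin K)) (hb : ∀ k, 0 < b k) (hβ : ∀ k, b k ≤ β)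
    (hPP : IsUnit (Pᵀ * P)) (hα : ∑ i, α i ^ 2 = 1) :
    ∑ k, ∑ l, SigmaMat P W b α k l ^ 2 ≤ 4 * β ^ 2 / Fintype.card m := by
  have hm : (0 : ℝ) < Fintype.card m := by simp [Fintype.card_pos]
  have hentry : ∀ k l, SigmaMat P W b α k l = (1 / (Fintype.card m : ℝ)) *
      ∑ i, ((residualProj P *ᵥ α) i * (P i ⬝ᵥ b)) *
        ((W i - rowMean W) k * (W i - rowMean W) l) := by
    intro k l
    simp [SigmaMat, Matrix.sum_apply, Matrix.vecMulVec_apply]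
  have hPb : ∀ i, |P i ⬝ᵥ b| ≤ β := by
    intro i
    have h0 : 0 ≤ P i ⬝ᵥ b := Finset.sum_nonneg fun k _ => mul_nonneg ((hP i).1 k) (hb k).le
    rw [abs_of_nonneg h0]
    calc P i ⬝ᵥ b ≤ ∑ k, P i k * β :=
          Finset.sum_le_sum fun k _ => mul_le_mul_of_nonneg_left (hβ k) ((hP i).1 k)
      _ = β := by rw [← Finset.sum_mul, (hP i).2, one_mul]
  set h := residualProj P *ᵥ α
  have hsum : ∑ i, |h i * (P i ⬝ᵥ b)| * ∑ k, (W i - rowMean W) k ^ 2 ≤ 2 * β * ∑ i, |h i| := by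
    rw [Finset.mul_sum]
    refine Finset.sum_le_sum fun i _ => ?_
    have h2 := sum_sub_sq_le_two (hW i) (rowMean_mem_stdSimplex hW)
    calc |h i * (P i ⬝ᵥ b)| * ∑ k, (W i - rowMean W) k ^ 2 ≤ (|h i| * β) * 2 := by
          rw [abs_mul]
          exact mul_le_mul (mul_le_mul_of_nonneg_left (hPb i) (abs_nonneg _)) h2
            (Finset.sum_nonneg fun k _ => sq_nonneg _)
            (mul_nonneg (abs_nonneg _) ((abs_nonneg _).trans (hPb i)))
      _ = 2 * β * |h i| := by ring
  -- Cauchy-Schwarz, with `‖H α‖ ≤ ‖α‖ = 1`.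
  have hl1 : (∑ i, |h i|) ^ 2 ≤ Fintype.card m := by
    refine (sq_sum_le_card_mul_sum_sq).trans ?_
    simp only [sq_abs, Finset.card_univ]
    have := sum_residualProj_mulVec_sq_le P hPP α
    rw [hα] at this
    nlinarith
  simp_rw [hentry, mul_pow, ← Finset.mul_sum]
  refine (mul_le_mul_of_nonneg_left (sum_sum_sq_sum_mul_le _ _) (by positivity)).trans ?_
  refine (mul_le_mul_of_nonneg_left (pow_le_pow_left₀
    (Finset.sum_nonneg fun i _ => by positivity) hsum 2) (by positivity)).trans ?_
  rw [mul_pow]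
  calc (1 / (Fintype.card m : ℝ)) ^ 2 * ((2 * β) ^ 2 * (∑ i, |h i|) ^ 2)
      ≤ (1 / (Fintype.card m : ℝ)) ^ 2 * ((2 * β) ^ 2 * Fintype.card m) := by gcongr
    _ = 4 * β ^ 2 / Fintype.card m := by field_simp; ring

theorem mul_sq_le_one_of_balanced {b : Fin K → ℝ} {c β : ℝ} (hc : 0 ≤ c) (hβ : 0 ≤ β)
    (hb : ∀ k, c * β ≤ b k) (hb1 : ∑ k, b k ^ 2 = 1) : K * (c * β) ^ 2 ≤ 1 := by
  calc K * (c * β) ^ 2 = ∑ _k : Fin K, (c * β) ^ 2 := by simp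
    _ ≤ ∑ k, b k ^ 2 :=
      Finset.sum_le_sum fun k _ => pow_le_pow_left₀ (mul_nonneg hc hβ) (hb k) 2
    _ = 1 := hb1

/-- The nondegeneracy of `Σ(α)` bounds the number of vertices. -/
theorem vertex_count_le [DecidableEq m] [Nonempty m] {P W : Matrix m (Fin K) ℝ}
    {b : Fin K → ℝ} {α : m → ℝ} {c₃ c₄ : ℝ} (hK : 2 ≤ K) (h3 : 0 < c₃) (h4 : 0 < c₄)
    (hP : ∀ i, P i ∈ stdSimplex ℝ (Fin K)) (hW : ∀ i, W i ∈ stdSimplex ℝ (Fin K))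
    (hb : ∀ k, 0 < b k) (hb1 : ∑ k, b k ^ 2 = 1) (hbal : ∀ k l, c₃ * b l ≤ b k)
    (hPP : IsUnit (Pᵀ * P)) (hα : ∑ i, α i ^ 2 = 1)
    (hS : c₄ / √(K * Fintype.card m) ≤ sv (SigmaMat P W b α) (K - 1)) :
    (K : ℝ) ≤ 1 + 4 / (c₃ * c₄) ^ 2 := by
  have : Nonempty (Fin K) := ⟨⟨0, by omega⟩⟩
  obtain ⟨l, hl⟩ := Finite.exists_max b
  have hm : (0 : ℝ) < Fintype.card m := by simp [Fintype.card_pos]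
  have hK' : (2 : ℝ) ≤ K := by exact_mod_cast hK
  have hβ := mul_sq_le_one_of_balanced h3.le (hb l).le (fun k => hbal k l) hb1
  have hF := sum_sq_SigmaMat_le hP hW hb hl hPP hα
  have hsv := mul_sv_sq_le_sum_sq (SigmaMat P W b α) (Nat.sub_le K 1)
  rw [Nat.cast_sub (by omega), Nat.cast_one] at hsv
  have hs2 : c₄ ^ 2 / (K * Fintype.card m) ≤ sv (SigmaMat P W b α) (K - 1) ^ 2 := by
    have := pow_le_pow_left₀ (by positivity) hS 2
    rwa [div_pow, Real.sq_sqrt (by positivity)] at this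
  have h1 : ((K : ℝ) - 1) * (c₄ ^ 2 / (K * Fintype.card m)) ≤ 4 * b l ^ 2 / Fintype.card m :=
    (mul_le_mul_of_nonneg_left hs2 (by linarith)).trans (hsv.trans hF)
  have h2 : ((K : ℝ) - 1) * c₄ ^ 2 ≤ 4 * b l ^ 2 * K := by
    rw [← mul_div_assoc, div_le_div_iff₀ (by positivity) hm] at h1
    refine le_of_mul_le_mul_right ?_ hm
    linarith
  rw [← sub_le_iff_le_add', le_div_iff₀ (by positivity)]
  -- Multiply `h2` by `c₃²` and use `K (c₃ max b)² ≤ 1`.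
  nlinarith [mul_le_mul_of_nonneg_left h2 (sq_nonneg c₃)]

/-- Test on the all-ones vector, which `P` maps to the all-ones vector. -/
theorem card_le_mul_sv_one_sq {P : Matrix m (Fin K) ℝ} (hP : ∀ i, P i ∈ stdSimplex ℝ (Fin K)) :
    (Fintype.card m : ℝ) ≤ K * sv P 1 ^ 2 := by
  have h := sum_mulVec_sq_le_sv P (fun _ => 1)
  simpa [Matrix.mulVec, dotProduct, fun i => (hP i).2, mul_comm] using h

/-- `W = D P diag(b)` with `D` diagonal: the entries of `D` are at least `1 / max b`, those of
`diag(b)` at least `c max b`, and `max b` cancels. -/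
theorem sum_mulVec_sq_le_of_reweight {P W : Matrix m (Fin K) ℝ} {b : Fin K → ℝ} {c : ℝ}
    (hc : 0 < c) (hP : ∀ i, P i ∈ stdSimplex ℝ (Fin K)) (hb : ∀ k, 0 < b k)
    (hbal : ∀ k l, c * b l ≤ b k) (hW : ∀ i, W i = reweight b (P i)) (v : Fin K → ℝ) :
    (c * sv P K) ^ 2 * ∑ k, v k ^ 2 ≤ ∑ i, (W *ᵥ v) i ^ 2 := by
  rcases isEmpty_or_nonempty (Fin K) with hK | hK
  · simpa using Finset.sum_nonneg fun i _ => sq_nonneg ((W *ᵥ v) i)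
  obtain ⟨l, hl⟩ := Finite.exists_max b
  have hβ := hb l
  have hs : ∀ i, ∑ k, |b k * P i k| ∈ Set.Ioc 0 (b l) := by
    intro i
    have habs : ∀ k, |b k * P i k| = b k * P i k := fun k =>
      abs_of_nonneg (mul_nonneg (hb k).le ((hP i).1 k))
    simp_rw [habs]
    constructor
    · calc 0 < c * b l := by positivity
        _ = ∑ k, c * b l * P i k := by rw [← Finset.mul_sum, (hP i).2, mul_one]
        _ ≤ _ := Finset.sum_le_sum fun k _ => mul_le_mul_of_nonneg_right (hbal k l) ((hP i).1 k)
    · calc ∑ k, b k * P i k ≤ ∑ k, b l * P i k :=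
            Finset.sum_le_sum fun k _ => mul_le_mul_of_nonneg_right (hl k) ((hP i).1 k)
        _ = b l := by rw [← Finset.mul_sum, (hP i).2, mul_one]
  have hWv : ∀ i, (W *ᵥ v) i = (P *ᵥ fun k => b k * v k) i / ∑ k, |b k * P i k| := by
    intro i
    simp only [Matrix.mulVec, dotProduct, hW, reweight, Finset.sum_div]
    refine Finset.sum_congr rfl fun k _ => ?_
    ring
  calc (c * sv P K) ^ 2 * ∑ k, v k ^ 2
      = (sv P K ^ 2 * ∑ k, (c * b l * v k) ^ 2) / b l ^ 2 := by
        simp_rw [mul_pow, ← Finset.mul_sum]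
        field_simp
    _ ≤ (sv P K ^ 2 * ∑ k, (b k * v k) ^ 2) / b l ^ 2 := by
        refine div_le_div_of_nonneg_right (mul_le_mul_of_nonneg_left
          (Finset.sum_le_sum fun k _ => ?_) (sq_nonneg _)) (sq_nonneg _)
        rw [mul_pow, mul_pow (b k)]
        have := hbal k l
        gcongr
    _ ≤ (∑ i, (P *ᵥ fun k => b k * v k) i ^ 2) / b l ^ 2 := by
        gcongr
        exact sv_mul_le_sum_mulVec_sq P _
    _ ≤ ∑ i, (W *ᵥ v) i ^ 2 := by
        rw [Finset.sum_div]
        refine Finset.sum_le_sum fun i _ => ?_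
        rw [hWv, div_pow]
        have := (hs i).1
        have := (hs i).2
        gcongr

end Weights

end SSVH

namespace SSVH

/-! ### Sub-Gaussian concentration of the noise -/

section Noise

variable {Ω : Type*} [MeasurableSpace Ω] {μ : Measure Ω} {n d K : ℕ} {S : Finset (Fin n)}
  {ε : Fin n → Ω → Fin d → ℝ} {σ : ℝ}

theorem hasSubgaussianMGF_mono {X : Ω → ℝ} {c c' : NNReal} (h : HasSubgaussianMGF X c μ)
    (hc : c ≤ c') : HasSubgaussianMGF X c' μ where
  integrable_exp_mul := h.integrable_exp_mul
  mgf_le t := (h.mgf_le t).trans (by gcongr)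

theorem hasSubgaussianMGF_sum_mul (hε : NoiseModel μ S ε σ) (j : Fin d) {a : Fin n → ℝ}
    (ha : ∀ i, |a i| ≤ 1) :
    HasSubgaussianMGF (fun ω => ∑ i ∈ S, a i * ε i ω j)
      (∑ _i ∈ S, Real.toNNReal (σ ^ 2)) μ := by
  refine HasSubgaussianMGF.sum_of_iIndepFun
    (hε.indep.comp (fun i y => a i * y j) fun i => by fun_prop) fun i hi => ?_
  refine hasSubgaussianMGF_mono ((hε.subgaussian i hi j).const_mul (a i)) ?_
  refine mul_le_of_le_one_left (zero_le) ?_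
  exact_mod_cast (sq_le_one_iff_abs_le_one (a i)).2 (ha i)

theorem measure_abs_sum_mul_ge_le [IsFiniteMeasure μ] (hε : NoiseModel μ S ε σ) (j : Fin d)
    {a : Fin n → ℝ} (ha : ∀ i, |a i| ≤ 1) {t : ℝ} (ht : 0 ≤ t) :
    μ.real {ω | t ≤ |∑ i ∈ S, a i * ε i ω j|} ≤
      2 * Real.exp (-t ^ 2 / (2 * (S.card * σ ^ 2))) := by
  have h := hasSubgaussianMGF_sum_mul hε j ha
  have h1 := h.measure_ge_le ht
  have h2 := h.neg.measure_ge_le ht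
  have hc : ((∑ _i ∈ S, Real.toNNReal (σ ^ 2) : NNReal) : ℝ) = S.card * σ ^ 2 := by
    simp [Real.coe_toNNReal _ (sq_nonneg σ)]
  rw [hc] at h1 h2
  calc μ.real {ω | t ≤ |∑ i ∈ S, a i * ε i ω j|}
      ≤ μ.real ({ω | t ≤ ∑ i ∈ S, a i * ε i ω j} ∪
          {ω | t ≤ (-fun ω => ∑ i ∈ S, a i * ε i ω j) ω}) :=
        measureReal_mono fun ω hω => le_abs.1 (show t ≤ |∑ i ∈ S, a i * ε i ω j| from hω)
    _ ≤ _ := (measureReal_union_le _ _).trans (by linarith)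

theorem measure_exists_abs_sum_mul_ge_le [IsFiniteMeasure μ] (hε : NoiseModel μ S ε σ)
    {w : Fin n → Fin K → ℝ} (hw : ∀ i k, |w i k| ≤ 1) {t : ℝ} (ht : 0 ≤ t) :
    μ.real {ω | ∃ k j, t ≤ |∑ i ∈ S, w i k * ε i ω j|} ≤
      K * d * (2 * Real.exp (-t ^ 2 / (2 * (S.card * σ ^ 2)))) := by
  have hset : {ω | ∃ k j, t ≤ |∑ i ∈ S, w i k * ε i ω j|} =
      ⋃ q : Fin K × Fin d, {ω | t ≤ |∑ i ∈ S, w i q.1 * ε i ω q.2|} := by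
    ext ω
    simp
  rw [hset]
  refine (measureReal_iUnion_fintype_le _).trans ?_
  refine (Finset.sum_le_sum fun q _ =>
    measure_abs_sum_mul_ge_le hε q.2 (fun i => hw i q.1) ht).trans_eq ?_
  simp

/-- Off an event of probability at most `2 / n`, every entry of the noise regressed on the weights
is at most `√(6 |S| σ² log n)`. -/
theorem one_sub_le_measure_abs_sum_mul_lt [IsProbabilityMeasure μ] (hε : NoiseModel μ S ε σ)
    {w : Fin n → Fin K → ℝ} (hw : ∀ i k, |w i k| ≤ 1) (hσ : 0 < σ) (hS : 0 < S.card)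
    (hK : K ≤ n) (hd : d ≤ n) :
    1 - 2 / (n : ℝ) ≤
      μ.real {ω | ∀ k j, |∑ i ∈ S, w i k * ε i ω j| ≤ √(6 * S.card * σ ^ 2 * Real.log n)} := by
  have hn : 0 < n := hS.trans_le ((Finset.card_le_univ S).trans_eq (Fintype.card_fin n))
  have hn' : (0 : ℝ) < n := by exact_mod_cast hn
  have hN : (0 : ℝ) < S.card := by exact_mod_cast hS
  have hlog : 0 ≤ Real.log n := Real.log_natCast_nonneg n
  set t := √(6 * S.card * σ ^ 2 * Real.log n) with ht
  -- The factor 6 makes the tail `n⁻³`, which absorbs the union bound over `K d ≤ n²` entries.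
  have hexp : Real.exp (-t ^ 2 / (2 * (S.card * σ ^ 2))) = ((n : ℝ) ^ 3)⁻¹ := by
    have : -t ^ 2 / (2 * (S.card * σ ^ 2)) = -(3 * Real.log n) := by
      rw [ht, Real.sq_sqrt (by positivity)]
      field_simp
      ring
    rw [this, Real.exp_neg, ← Real.exp_log (pow_pos hn' 3), Real.log_pow]
    norm_num
  have hbad := measure_exists_abs_sum_mul_ge_le (t := t) hε hw (Real.sqrt_nonneg _)
  rw [hexp] at hbad
  have hbound : (K : ℝ) * d * (2 * ((n : ℝ) ^ 3)⁻¹) ≤ 2 / n := by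
    calc (K : ℝ) * d * (2 * ((n : ℝ) ^ 3)⁻¹) ≤ n * n * (2 * ((n : ℝ) ^ 3)⁻¹) := by gcongr
      _ = 2 / n := by field_simp
  have hcover : 1 ≤ μ.real {ω | ∀ k j, |∑ i ∈ S, w i k * ε i ω j| ≤ t} +
      μ.real {ω | ∃ k j, t ≤ |∑ i ∈ S, w i k * ε i ω j|} := by
    refine le_trans ?_ (measureReal_union_le _ _)
    rw [← probReal_univ (μ := μ)]
    refine measureReal_mono fun ω _ => ?_
    by_contra hω
    simp only [Set.mem_union, Set.mem_ofPred_eq, not_or, not_forall, not_exists, not_le] at hω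
    obtain ⟨⟨k, j, h⟩, h'⟩ := hω
    exact lt_asymm h (h' k j)
  linarith

end Noise

end SSVH

/-! ### Regression error and conclusion -/

namespace SSVH

theorem stack_signal_add {n K d : ℕ} (S : Finset (Fin n)) (V : Matrix (Fin K) (Fin d) ℝ)
    (w : Fin n → Fin K → ℝ) (e : Fin n → Fin d → ℝ) :
    stack S (fun i => signal V (w i) + e i) = stack S w * V + stack S e := by
  ext i j
  simp [stack, signal, Matrix.mul_apply, Finset.sum_apply]

theorem regression_sub_eq {m : Type*} [Fintype m] {K d : ℕ} {W : Matrix m (Fin K) ℝ}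
    (hW : IsUnit (Wᵀ * W)) (V : Matrix (Fin K) (Fin d) ℝ) (E : Matrix m (Fin d) ℝ) :
    regression W (W * V + E) - V = (Wᵀ * W)⁻¹ * (Wᵀ * E) := by
  have hU := (Matrix.isUnit_iff_isUnit_det _).1 hW
  rw [regression, Matrix.mul_add, Matrix.mul_assoc, ← Matrix.mul_assoc Wᵀ, ← Matrix.mul_assoc,
    Matrix.nonsing_inv_mul _ hU, Matrix.one_mul, add_sub_cancel_left, Matrix.mul_assoc]

theorem norm_regression_sub_le {m : Type*} [Fintype m] {K d : ℕ} {W : Matrix m (Fin K) ℝ}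
    {κ τ : ℝ} (hκ : 0 < κ) (hτ : 0 ≤ τ) (hd : d ≤ K)
    (h : ∀ v, κ * ∑ j, v j ^ 2 ≤ ∑ i, (W *ᵥ v) i ^ 2) (V : Matrix (Fin K) (Fin d) ℝ)
    (E : Matrix m (Fin d) ℝ) (hE : ∀ k j, |(Wᵀ * E) k j| ≤ τ) :
    ‖regression W (W * V + E) - V‖ ≤ κ⁻¹ * (K * τ) := by
  rw [regression_sub_eq (isUnit_gram_of_le W hκ h)]
  refine (Matrix.l2_opNorm_mul _ _).trans (mul_le_mul (l2_opNorm_inv_gram_le W hκ h) ?_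
    (norm_nonneg _) (by positivity))
  refine (l2_opNorm_le_of_abs_entry_le _ hτ hE).trans (mul_le_mul_of_nonneg_right ?_ hτ)
  refine Real.sqrt_le_iff.2 ⟨by positivity, ?_⟩
  simp only [Fintype.card_fin]
  rw [sq]
  gcongr

end SSVH

theorem lemma3 :
    ∃ C₀ : ℝ, 0 < C₀ ∧
    ∀ c₁ c₂ c₃ c₄ Cerr : ℝ, 0 < c₁ → 0 < c₂ → 0 < c₃ → 0 < c₄ → 0 < Cerr →
    ∃ C : ℝ, 0 < C ∧
    ∀ c₆ : ℝ, 0 < c₆ →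
    ∀ (n K d : ℕ), 2 ≤ K → d ≤ K →
    ∀ (S : Finset (Fin n)) (V : Matrix (Fin K) (Fin d) ℝ) (w : Fin n → Fin K → ℝ)
      (P : Matrix S (Fin K) ℝ) (b : Fin K → ℝ) (α : S → ℝ) (σ : ℝ)
      {Ω : Type*} [MeasurableSpace Ω] (μ : Measure Ω) [IsProbabilityMeasure μ]
      (ε : Fin n → Ω → Fin d → ℝ) (x : Fin n → Ω → Fin d → ℝ),
    -- the model
    SSVH.LabelModel S w P b →
    (∀ i ω, x i ω = SSVH.signal V (w i) + ε i ω) →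
    0 < σ → SSVH.NoiseModel μ S ε σ →
    -- the regularity conditions
    SSVH.Regular c₁ c₂ c₃ V P b →
    ‖WithLp.toLp 2 α‖ = 1 →
    c₄ / Real.sqrt (K * S.card) ≤ SSVH.sv (SSVH.SigmaMat P (SSVH.stack S w) b α) (K - 1) →
    -- the number of labeled points
    (1 / c₆ ^ 2) * (σ ^ 2 * ((K : ℝ) ^ 2 + Cerr ^ 2 * (K : ℝ) ^ (3 / 2 : ℝ) * Real.log n))
      < (S.card : ℝ) →
    IsUnit ((SSVH.stack S w)ᵀ * SSVH.stack S w) ∧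
    1 - C₀ / n ≤ μ.real {ω |
      ‖SSVH.regression (SSVH.stack S w) (SSVH.stack S fun i => x i ω) - V‖ ≤
        ‖V‖ * (C * (S.card : ℝ) ^ (-(1 / 2) : ℝ) * (K : ℝ) ^ (5 / 4 : ℝ) * σ *
          Real.sqrt (Real.log n))} := by
  refine ⟨2, two_pos, fun c₁ c₂ c₃ c₄ Cerr h1 h2 h3 h4 hC => ?_⟩
  set K₀ : ℝ := 1 + 4 / (c₃ * c₄) ^ 2
  -- `√6` comes from the noise level, `K₀²` bounds `K²`, `(c₂ c₃)²` comes from the Gram bound, and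
  -- `c₁` from `1 ≤ ‖V‖ / c₁`.
  refine ⟨√6 * K₀ ^ 2 / (c₁ * (c₂ * c₃) ^ 2), by positivity, ?_⟩
  intro c₆ h6 n K d hK hd S V w P b α σ Ω _ μ _ ε x hmodel hx hσ hε hreg hα hsv hN
  obtain ⟨hw, hP, hb, hb1, hWeq⟩ := hmodel
  obtain ⟨hV, -, hPs, hbal⟩ := hreg
  have hK' : (0 : ℝ) < K := by exact_mod_cast (by omega : 0 < K)
  have hcard : (0 : ℝ) < S.card := by
    refine lt_of_le_of_lt ?_ hN
    have := Real.log_natCast_nonneg n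
    positivity
  have hcard' : 0 < S.card := by exact_mod_cast hcard
  have hm : (Fintype.card S : ℝ) = S.card := by simp
  have : Nonempty S := (Finset.card_pos.1 hcard').to_subtype
  replace hb1 : ∑ k, b k ^ 2 = 1 := by rw [← SSVH.norm_toLp_sq_eq_sum, hb1, one_pow]
  replace hα : ∑ i, α i ^ 2 = 1 := by rw [← SSVH.norm_toLp_sq_eq_sum, hα, one_pow]
  -- singular values of the label matrix
  have hs1 : (S.card : ℝ) / K ≤ SSVH.sv P 1 ^ 2 := by
    rw [div_le_iff₀' hK', ← hm]
    exact SSVH.card_le_mul_sv_one_sq hP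
  have hsK : c₂ ^ 2 * (S.card / K) ≤ SSVH.sv P K ^ 2 := by
    calc c₂ ^ 2 * (S.card / K) ≤ c₂ ^ 2 * SSVH.sv P 1 ^ 2 := by gcongr
      _ = (c₂ * SSVH.sv P 1) ^ 2 := by ring
      _ ≤ _ := pow_le_pow_left₀ (mul_nonneg h2.le (SSVH.sv_nonneg _ _)) hPs 2
  have hPP : IsUnit (Pᵀ * P) := SSVH.isUnit_gram_of_le P (lt_of_lt_of_le (by positivity) hsK)
    fun v => SSVH.sv_mul_le_sum_mulVec_sq P v
  -- the weight matrix
  set W := SSVH.stack S w with hW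
  have hWs : ∀ i, W i ∈ stdSimplex ℝ (Fin K) := fun i => hw i
  have hgram : ∀ v, ((c₂ * c₃) ^ 2 * (S.card / K)) * ∑ j, v j ^ 2 ≤ ∑ i, (W *ᵥ v) i ^ 2 := by
    intro v
    refine le_trans ?_ (SSVH.sum_mulVec_sq_le_of_reweight h3 hP hb hbal (fun i => hWeq i) v)
    refine mul_le_mul_of_nonneg_right ?_ (Finset.sum_nonneg fun _ _ => sq_nonneg _)
    calc (c₂ * c₃) ^ 2 * (S.card / K) = c₃ ^ 2 * (c₂ ^ 2 * (S.card / K)) := by ring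
      _ ≤ c₃ ^ 2 * SSVH.sv P K ^ 2 := by gcongr
      _ = _ := by ring
  have hκ : 0 < (c₂ * c₃) ^ 2 * ((S.card : ℝ) / K) := by positivity
  refine ⟨SSVH.isUnit_gram_of_le W hκ hgram, ?_⟩
  have hKK₀ : (K : ℝ) ≤ K₀ :=
    SSVH.vertex_count_le hK h3 h4 hP hWs hb hb1 hbal hPP hα (by rwa [hm])
  -- The label matrix has rank `K` and at most `n` rows.
  have hKn : K ≤ n := by
    have hr : (Pᵀ * P).rank = K := by
      rw [Matrix.rank_of_isUnit _ hPP, Fintype.card_fin]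
    have := (Matrix.rank_mul_le_right Pᵀ P).trans P.rank_le_card_height
    rw [hr, Fintype.card_coe] at this
    exact this.trans ((Finset.card_le_univ S).trans_eq (Fintype.card_fin n))
  have hwabs : ∀ i k, |w i k| ≤ 1 := fun i k => by
    rw [abs_of_nonneg ((hw i).1 k)]
    exact SSVH.le_one_of_mem_stdSimplex (hw i) k
  refine (SSVH.one_sub_le_measure_abs_sum_mul_lt hε hwabs hσ hcard' hKn (hd.trans hKn)).trans
    (measureReal_mono fun ω hω => ?_)
  set τ := √(6 * S.card * σ ^ 2 * Real.log n) with hτ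
  have hX : (SSVH.stack S fun i => x i ω) = W * V + SSVH.stack S (fun i => ε i ω) := by
    rw [hW, ← SSVH.stack_signal_add]
    simp_rw [hx]
  rw [Set.mem_ofPred_eq, hX]
  refine (SSVH.norm_regression_sub_le hκ (Real.sqrt_nonneg _) hd hgram V _ (τ := τ)
    fun k j => ?_).trans ?_
  · refine le_of_eq_of_le (congrArg abs ?_) (hω k j)
    rw [Matrix.mul_apply, ← Finset.sum_coe_sort S]
    rfl
  have hτ' : τ = √6 * √S.card * σ * √(Real.log n) := by
    rw [hτ, Real.sqrt_mul (by positivity), Real.sqrt_mul (by positivity),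
      Real.sqrt_mul (by positivity), Real.sqrt_sq hσ.le]
  have hNrpow : (S.card : ℝ) ^ (-(1 / 2) : ℝ) = √S.card / S.card := by
    rw [Real.rpow_neg hcard.le, ← Real.sqrt_eq_rpow, Real.sqrt_div_self', one_div]
  have hKrpow : (1 : ℝ) ≤ (K : ℝ) ^ (5 / 4 : ℝ) :=
    Real.one_le_rpow (by exact_mod_cast (by omega : 1 ≤ K)) (by norm_num)
  set R := √6 * (√S.card / S.card) * σ * √(Real.log n) / (c₂ * c₃) ^ 2
  have hR : 0 ≤ R := by positivity
  have hV1 : 1 ≤ ‖V‖ / c₁ := (one_le_div h1).2 hV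
  -- One factor `K` comes from the inverse Gram matrix, the other from passing from entries to the
  -- spectral norm. Once `K²` is replaced by `K₀²`, the factor `K^(5/4)` enters only through being
  -- at least 1.
  calc ((c₂ * c₃) ^ 2 * ((S.card : ℝ) / K))⁻¹ * (K * τ) = (K : ℝ) ^ 2 * R := by
        rw [hτ']
        simp only [R]
        field_simp
    _ ≤ K₀ ^ 2 * R := by gcongr
    _ ≤ (‖V‖ / c₁ * (K : ℝ) ^ (5 / 4 : ℝ)) * (K₀ ^ 2 * R) :=
        le_mul_of_one_le_left (by positivity) (one_le_mul_of_one_le_of_one_le hV1 hKrpow)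
    _ = _ := by
        rw [hNrpow]
        simp only [R]
        field_simp
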